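/- Fix the standard inner product and the standard orthonormal basis of $\mathbb{R}^n$, and write $x(l)$ for the $l$-th coordinate of $x\in\mathbb{R}^n$ and $|\cdot|$ for volume. A symmetric convex body is a convex compact set $K\subset\mathbb{R}^n$ with non-empty interior and $K=-K$. A set $A\subseteq\mathbb{R}^n$ is unconditional if, for all $\delta_1,\dots,\delta_n\in\{-1,1\}$ and all $x\in\mathbb{R}^n$, $(\delta_1x(1),\dots,\delta_nx(n))\in A$ if and only if $x\in A$. For $p>0$ let $B_p^n=\{x\in\mathbb{R}^n:\ (\sum_{l=1}^n|x(l)|^p)^{1/p}\le 1\}$. For integers $1\le j\le k$ and $x_1,\dots,x_k\in\mathbb{R}^n$ put $$\mathcal{E}_j(x_1,\dots,x_k)=\binom{k}{j}^{-1}\sum_{l=1}^n\ \sum_{1\le i_1<\dots<i_j\le k}x_{i_1}(l)\cdots x_{i_j}(l).$$ Sets $K_1,\dots,K_k\subseteq\mathbb{R}^n$ satisfy the $\mathcal{E}_j$-polarity condition if $\mathcal{E}_j(x_1,\dots,x_k)\le 1$ whenever $x_i\in K_i$ for $i=1,\dots,k$. **Theorem.** Let $2\le j\le k$ be integers and let $K_1,\dots,K_k$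 be symmetric convex bodies in $\mathbb{R}^n$ satisfying the $\mathcal{E}_j$-polarity condition. Then $$\prod_{i=1}^k|K_i|\le|B_j^n|^k$$ in each of the following cases: (i) $K_1,\dots,K_k$ are unconditional; (ii) $j=k$; (iii) $j$ is even and $K_3,\dots,K_k$ are unconditional. Moreover, in all three cases the inequality is sharp for $K_1=\dots=K_k=B_j^n$: for all integers $2\le j\le k$, $B_j^n$ is an unconditional symmetric convex body, the $k$-tuple $(B_j^n,\dots,B_j^n)$ satisfies the $\mathcal{E}_j$-polarity condition, and it attains equality. -/

import Mathlib

open MeasureTheory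

noncomputable section

/-- A symmetric convex body in `ℝⁿ`: a convex compact set `K` with non-empty interior
such that `K = -K`. -/
structure IsSymmConvexBody {n : ℕ} (K : Set (EuclideanSpace ℝ (Fin n))) : Prop where
  convex : Convex ℝ K
  isCompact : IsCompact K
  interior_nonempty : (interior K).Nonempty
  symm : ∀ x ∈ K, -x ∈ K

/-- A set is unconditional if it is invariant under all changes of signs of the coordinates. -/
def IsUnconditional {n : ℕ} (A : Set (EuclideanSpace ℝ (Fin n))) : Prop :=
  ∀ δ : Fin n → ℝ, (∀ l, δ l = 1 ∨ δ l = -1) →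
    ∀ x : EuclideanSpace ℝ (Fin n), WithLp.toLp 2 (fun l => δ l * x l) ∈ A ↔ x ∈ A

/-- `‖x‖_p = (∑ₘ |xₘ|^p)^(1/p)`, used for `p > 0`. -/
def lpFunctional {n : ℕ} (p : ℝ) (x : EuclideanSpace ℝ (Fin n)) : ℝ :=
  (∑ m, |x m| ^ p) ^ (1 / p)

/-- The `l_p`-ball `B_p^n = {x ∈ ℝⁿ : ‖x‖_p ≤ 1}`. -/
def lpBall (n : ℕ) (p : ℝ) : Set (EuclideanSpace ℝ (Fin n)) :=
  {x | lpFunctional p x ≤ 1}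

/-- The elementary symmetric polynomial `s_j(r₁, …, r_k)` of degree `j` in `k` variables. -/
def elemSymm {k : ℕ} (j : ℕ) (r : Fin k → ℝ) : ℝ :=
  MvPolynomial.eval r (MvPolynomial.esymm (Fin k) ℝ j)

theorem elemSymm_eq_sum {k : ℕ} (j : ℕ) (r : Fin k → ℝ) :
    elemSymm j r = ∑ s ∈ Finset.powersetCard j Finset.univ, ∏ i ∈ s, r i := by
  simp [elemSymm, MvPolynomial.esymm]

/-- `S_j(x₁, …, x_k) = ∑ₗ s_j(x₁(l), …, x_k(l))`. -/
def coordSymm {n k : ℕ} (j : ℕ) (x : Fin k → EuclideanSpace ℝ (Fin n)) : ℝ :=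
  ∑ l, elemSymm j (fun i => x i l)

/-- `E_j = S_j / (k choose j)`. -/
def coordSymmMean {n k : ℕ} (j : ℕ) (x : Fin k → EuclideanSpace ℝ (Fin n)) : ℝ :=
  coordSymm j x / (k.choose j : ℝ)

/-- The sets `K₁, …, K_k` satisfy the `Φ`-polarity condition:
`Φ(x₁, …, x_k) ≤ 1` whenever `x_i ∈ K_i` for all `i`. -/
def PolarityCondition {n k : ℕ} (Φ : (Fin k → EuclideanSpace ℝ (Fin n)) → ℝ)
    (K : Fin k → Set (EuclideanSpace ℝ (Fin n))) : Prop :=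
  ∀ x : Fin k → EuclideanSpace ℝ (Fin n), (∀ i, x i ∈ K i) → Φ x ≤ 1

end

open scoped ENNReal Pointwise

/-! For unconditional bodies, coordinates may be replaced by their absolute values. If `|z(l)|^k = ∏
|x_i(l)|` for every `l`, Maclaurin's inequality gives `C(k,j) ∑ |z(l)|^j ≤ ∑ s_j(|x_1(l)|, …,
|x_k(l)|) ≤ C(k,j)`, so `z` lies in the ball. The Prékopa–Leindler inequality for coordinatewise
geometric means (`prekopaLeindler_real_mul`, tensorised by `PrekopaLeindler.pi`) turns this
inclusion into the volume bound `prod_volume_le_of_flipOn_mem`.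

The other cases reduce to this one by symmetrization. Given two of the bodies and a coordinate `l`,
one is replaced by its fibrewise `(K - K)/2` in direction `l`, the other by the same in all
remaining directions. By Brunn–Minkowski on fibres, volumes do not drop. As `s_j` is affine in each
variable, its coordinate sum at new points is the average of a value at old points and a value at
old points with the `l`-th coordinates of the two bodies flipped (`SymmPolar.symmetrizePair`). That
flip is harmless if `j = k`, where two signs cancel, and if `j` is even and the other bodies are
unconditional, where it amounts to flipping those others. Finitely many steps make every body
unconditional.

Sharpness is AM–GM applied to each monomial. -/

/-! ### Brunn–Minkowski and Prékopa–Leindler on the line -/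

/-- With `a = max A` and `b = min B`, the translates `b + A` and `a + B` both lie in `A + B` and
meet only at `a + b`. -/
theorem Real.volume_add_volume_le {A B : Set ℝ} (hA : IsCompact A) (hB : IsCompact B)
    (hA' : A.Nonempty) (hB' : B.Nonempty) : volume A + volume B ≤ volume (A + B) := by
  have ha := hA.sSup_mem hA'
  have hb := hB.sInf_mem hB'
  set a := sSup A
  set b := sInf B
  have hdisj : AEDisjoint volume ((fun x => b + x) '' A) ((fun x => a + x) '' B) := by
    refine measure_mono_null (t := {a + b}) ?_ (by simp)
    rintro _ ⟨⟨x, hx, rfl⟩, ⟨y, hy, hxy⟩⟩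
    have h1 : x ≤ a := le_csSup hA.bddAbove hx
    have h2 : b ≤ y := csInf_le hB.bddBelow hy
    simp only [Set.mem_singleton_iff] at *
    linarith
  have hBm : MeasurableSet ((fun x => a + x) '' B) := (hB.image (by fun_prop)).measurableSet
  calc volume A + volume B = volume ((fun x => b + x) '' A) + volume ((fun x => a + x) '' B) := by
        simp
    _ = volume ((fun x => b + x) '' A ∪ (fun x => a + x) '' B) :=
        (measure_union₀ hBm.nullMeasurableSet hdisj).symm
    _ ≤ volume (A + B) := by
        refine measure_mono (Set.union_subset ?_ ?_)
        · rintro _ ⟨x, hx, rfl⟩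
          exact ⟨x, hx, b, hb, add_comm _ _⟩
        · rintro _ ⟨x, hx, rfl⟩
          exact ⟨a, ha, x, hx, rfl⟩

theorem isCompact_finset_sum_set {κ : Type*} (s : Finset κ) {A : κ → Set ℝ}
    (hA : ∀ i, IsCompact (A i)) : IsCompact (∑ i ∈ s, A i) := by
  classical
  induction s using Finset.induction_on with
  | empty => simp [← Set.singleton_zero]
  | insert i s hi ih => rw [Finset.sum_insert hi]; exact (hA i).add ih

theorem nonempty_finset_sum_set {κ : Type*} (s : Finset κ) {A : κ → Set ℝ}
    (hA : ∀ i, (A i).Nonempty) : (∑ i ∈ s, A i).Nonempty := by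
  classical
  induction s using Finset.induction_on with
  | empty => simp
  | insert i s hi ih => rw [Finset.sum_insert hi]; exact (hA i).add ih

theorem Real.sum_volume_le_volume_sum {κ : Type*} (s : Finset κ) {A : κ → Set ℝ}
    (hA : ∀ i, IsCompact (A i)) (hA' : ∀ i, (A i).Nonempty) :
    ∑ i ∈ s, volume (A i) ≤ volume (∑ i ∈ s, A i) := by
  classical
  induction s using Finset.induction_on with
  | empty => simp
  | insert i s hi ih =>
    rw [Finset.sum_insert hi, Finset.sum_insert hi]
    exact (add_le_add le_rfl ih).trans (Real.volume_add_volume_le (hA i)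
      (isCompact_finset_sum_set s hA) (hA' i) (nonempty_finset_sum_set s hA'))

theorem Real.exists_seq_isCompact_tendsto_volume {A : Set ℝ} (hA : MeasurableSet A)
    (hA' : A.Nonempty) : ∃ K : ℕ → Set ℝ, (∀ n, IsCompact (K n) ∧ (K n).Nonempty ∧ K n ⊆ A) ∧
      Filter.Tendsto (fun n => volume (K n)) Filter.atTop (nhds (volume A)) := by
  rcases eq_or_ne (volume A) 0 with h0 | h0
  · obtain ⟨a, ha⟩ := hA'
    exact ⟨fun _ => {a}, fun _ => ⟨isCompact_singleton, Set.singleton_nonempty a,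
      Set.singleton_subset_iff.2 ha⟩, by simp [h0]⟩
  · obtain ⟨u, -, hu, hlim⟩ := exists_seq_strictMono_tendsto' (pos_iff_ne_zero.2 h0)
    choose K hKA hK hlt using fun n => hA.exists_lt_isCompact (hu n).2
    refine ⟨K, fun n => ⟨hK n, ?_, hKA n⟩, ?_⟩
    · exact nonempty_of_measure_ne_zero (ne_of_gt ((hu n).1.trans (hlt n)))
    · exact tendsto_of_tendsto_of_tendsto_of_le_of_le hlim tendsto_const_nhds
        (fun n => (hlt n).le) (fun n => measure_mono (hKA n))

/-- Inner approximation by compact sets reduces this to the compact case and avoids measurability of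
sumsets. -/
theorem Real.sum_volume_le_card_mul_volume {κ : Type*} [Fintype κ] [Nonempty κ] {A : κ → Set ℝ}
    {C : Set ℝ} (hA : ∀ i, MeasurableSet (A i)) (hA' : ∀ i, (A i).Nonempty)
    (hC : ∀ (x : κ → ℝ) (z : ℝ), (∀ i, x i ∈ A i) → Fintype.card κ * z = ∑ i, x i → z ∈ C) :
    ∑ i, volume (A i) ≤ Fintype.card κ * volume C := by
  choose K hK hlim using fun i => Real.exists_seq_isCompact_tendsto_volume (hA i) (hA' i)
  refine le_of_tendsto' (tendsto_finsetSum Finset.univ fun i _ => hlim i) fun n => ?_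
  refine (Real.sum_volume_le_volume_sum Finset.univ (fun i => (hK i n).1)
    (fun i => (hK i n).2.1)).trans ?_
  have hN : (Fintype.card κ : ℝ) ≠ 0 := by simp
  have : volume ((Fintype.card κ : ℝ) • C) = Fintype.card κ * volume C := by
    rw [Measure.addHaar_smul]
    simp
  rw [← this]
  refine measure_mono fun y hy => ?_
  obtain ⟨x, hx, rfl⟩ := (Set.mem_finsetSum _ _ _).1 hy
  rw [Set.mem_smul_set_iff_inv_smul_mem₀ hN]
  exact hC x _ (fun i => (hK i n).2.2 (hx (Finset.mem_univ i)))
    (by rw [smul_eq_mul, mul_inv_cancel_left₀ hN])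

/-- The Prékopa–Leindler inequality for `κ`-tuples of functions, with respect to a relation
`M x z` saying that `z` is a mean of the points `x i`. -/
def PrekopaLeindler {X : Type*} [MeasurableSpace X] (μ : Measure X) {κ : Type*} [Fintype κ]
    (M : (κ → X) → X → Prop) : Prop :=
  ∀ (f : κ → X → ℝ≥0∞) (h : X → ℝ≥0∞), (∀ i, Measurable (f i)) → Measurable h →
    (∀ x z, M x z → ∏ i, f i (x i) ≤ h z ^ Fintype.card κ) →
    ∏ i, ∫⁻ x, f i x ∂μ ≤ (∫⁻ x, h x ∂μ) ^ Fintype.card κ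

theorem Real.prod_le_arith_mean_pow {κ : Type*} (s : Finset κ) (hs : s.Nonempty) (r : κ → ℝ)
    (hr : ∀ i ∈ s, 0 ≤ r i) : ∏ i ∈ s, r i ≤ ((∑ i ∈ s, r i) / s.card) ^ s.card := by
  have hN : (s.card : ℝ) ≠ 0 := by simpa using hs.ne_empty
  have h := Real.geom_mean_le_arith_mean s (fun _ => 1) r (by simp) (by simpa using hs) hr
  simp only [Real.rpow_one, Finset.sum_const, nsmul_eq_mul, mul_one, one_mul] at h
  have hp : 0 ≤ ∏ i ∈ s, r i := Finset.prod_nonneg hr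
  calc ∏ i ∈ s, r i = ((∏ i ∈ s, r i) ^ ((s.card : ℝ)⁻¹)) ^ s.card := by
        rw [← Real.rpow_natCast, ← Real.rpow_mul hp, inv_mul_cancel₀ hN, Real.rpow_one]
    _ ≤ _ := pow_le_pow_left₀ (Real.rpow_nonneg hp _) h _

theorem ENNReal.prod_le_pow_of_sum_le {κ : Type*} [Fintype κ] [Nonempty κ] (r : κ → ℝ≥0∞)
    (c : ℝ≥0∞) (h : ∑ i, r i ≤ Fintype.card κ * c) :
    ∏ i, r i ≤ c ^ Fintype.card κ := by
  rcases eq_or_ne c ∞ with rfl | hc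
  · simp
  have hsum : ∑ i, r i ≠ ∞ := ne_top_of_le_ne_top (by finiteness) h
  have hr : ∀ i, r i ≠ ∞ := fun i =>
    ne_top_of_le_ne_top hsum (Finset.single_le_sum (fun _ _ => zero_le) (Finset.mem_univ i))
  have hN : (0 : ℝ) < Fintype.card κ := by exact_mod_cast Fintype.card_pos
  rw [← ENNReal.toReal_le_toReal (ENNReal.prod_ne_top fun i _ => hr i) (by finiteness),
    ENNReal.toReal_prod, ENNReal.toReal_pow]
  refine (Real.prod_le_arith_mean_pow Finset.univ Finset.univ_nonempty _ (by simp)).trans ?_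
  rw [Finset.card_univ]
  refine pow_le_pow_left₀ (by positivity) ?_ _
  rw [div_le_iff₀' hN, ← ENNReal.toReal_sum fun i _ => hr i]
  have := ENNReal.toReal_mono (by finiteness) h
  simpa using this

/-- Layer cake. Stopping at level 1 keeps the superlevel sets nonempty for functions with supremum
1. -/
theorem ENNReal.lintegral_eq_lintegral_volume_lt {f : ℝ → ℝ≥0∞} (hf : Measurable f)
    (h1 : ∀ x, f x ≤ 1) :
    ∫⁻ x, f x = ∫⁻ t in Set.Ico (0 : ℝ) 1, volume {x | ENNReal.ofReal t < f x} := by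
  have hfin : ∀ x, f x ≠ ∞ := fun x => ne_top_of_le_ne_top ENNReal.one_ne_top (h1 x)
  have h := lintegral_eq_lintegral_meas_lt (volume : Measure ℝ) (f := fun x => (f x).toReal)
    (Filter.Eventually.of_forall fun x => ENNReal.toReal_nonneg) hf.ennreal_toReal.aemeasurable
  simp only [ENNReal.ofReal_toReal (hfin _)] at h
  rw [h, ← Set.Ioc_union_Ioi_eq_Ioi (zero_le_one' ℝ), lintegral_union measurableSet_Ioi
    (Set.disjoint_left.2 fun x hx hx' => not_lt.2 hx.2 hx')]
  have h2 : ∫⁻ t in Set.Ioi (1 : ℝ), volume {x | t < (f x).toReal} = 0 := by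
    rw [setLIntegral_congr_fun (g := fun _ => 0) measurableSet_Ioi fun t ht => ?_, lintegral_zero]
    have : ∀ x, ¬ t < (f x).toReal := fun x => not_lt.2 <|
      (ENNReal.toReal_mono ENNReal.one_ne_top (h1 x)).trans (by simpa using ht.out.le)
    simp [this]
  rw [h2, add_zero, setLIntegral_congr Ico_ae_eq_Ioc.symm]
  refine setLIntegral_congr_fun measurableSet_Ico fun t ht => ?_
  simp only [ENNReal.ofReal_lt_iff_lt_toReal ht.1 (hfin _)]

/-- At each level `t < 1` the sets `{f i > t}` are nonempty and their means lie in `{min h 1 > t}`.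
Integrating Brunn–Minkowski over `t` bounds the arithmetic mean of the integrals, which is stronger
than the product bound. -/
theorem prekopaLeindler_real_of_iSup_eq_one {κ : Type*} [Fintype κ] [Nonempty κ]
    {f : κ → ℝ → ℝ≥0∞} {h : ℝ → ℝ≥0∞} (hf : ∀ i, Measurable (f i)) (hh : Measurable h)
    (hsup : ∀ i, ⨆ x, f i x = 1)
    (H : ∀ (x : κ → ℝ) (z : ℝ), Fintype.card κ * z = ∑ i, x i →
      ∏ i, f i (x i) ≤ h z ^ Fintype.card κ) :
    ∏ i, ∫⁻ x, f i x ≤ (∫⁻ x, h x) ^ Fintype.card κ := by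
  have hf1 : ∀ i x, f i x ≤ 1 := fun i x => hsup i ▸ le_iSup (f i) x
  refine (ENNReal.prod_le_pow_of_sum_le _ (∫⁻ x, min (h x) 1) ?_).trans
    (pow_le_pow_left' (lintegral_mono fun x => min_le_left _ _) _)
  simp only [fun i => ENNReal.lintegral_eq_lintegral_volume_lt (hf i) (hf1 i)]
  rw [ENNReal.lintegral_eq_lintegral_volume_lt (hh.min measurable_const)
    (fun x => min_le_right _ _)]
  have hanti : ∀ g : ℝ → ℝ≥0∞, Measurable fun t : ℝ => volume {x | ENNReal.ofReal t < g x} :=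
    fun g => Antitone.measurable fun s t hst => measure_mono fun x hx =>
      (ENNReal.ofReal_le_ofReal hst).trans_lt hx
  rw [← lintegral_finsetSum _ fun i _ => hanti (f i), ← lintegral_const_mul _ (hanti _)]
  refine setLIntegral_mono ((hanti _).const_mul _) fun t ht => ?_
  have ht1 : ENNReal.ofReal t < 1 := by simpa using ht.2
  refine Real.sum_volume_le_card_mul_volume (fun i => measurableSet_lt measurable_const (hf i))
    (fun i => lt_iSup_iff.1 (ht1.trans_eq (hsup i).symm)) fun x z hx hz => ?_
  refine lt_min ?_ ht1
  by_contra! hle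
  have h1 := (H x z hz).trans (pow_le_pow_left' hle _)
  -- The smallest factor, raised to the number of factors, is at most the product, hence at most the
  -- same power of `t`.
  obtain ⟨i₀, -, hi₀⟩ := Finset.exists_min_image Finset.univ (fun i => f i (x i))
    Finset.univ_nonempty
  have h2 := (Finset.pow_card_le_prod Finset.univ _ _ hi₀).trans h1
  rw [Finset.card_univ] at h2
  exact not_le.2 (hx i₀) ((ENNReal.pow_right_strictMono Fintype.card_ne_zero).le_iff_le.1 h2)

/-- The suprema are removed one factor at a time; `c` absorbs the factors already treated. -/
theorem ENNReal.prod_iSup_mul_le {κ ι : Type*} [Nonempty ι] (s : Finset κ) (F : κ → ι → ℝ≥0∞) (c C : ℝ≥0∞)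
    (h : ∀ m : κ → ι, (∏ i ∈ s, F i (m i)) * c ≤ C) : (∏ i ∈ s, ⨆ n, F i n) * c ≤ C := by
  classical
  induction s using Finset.induction_on generalizing c with
  | empty => simpa using h fun _ => Classical.arbitrary ι
  | insert i s hi ih =>
    rw [Finset.prod_insert hi, mul_right_comm, ENNReal.iSup_mul, ENNReal.iSup_mul]
    refine iSup_le fun n => ?_
    rw [mul_comm]
    refine ih _ fun m => ?_
    have := h (Function.update m i n)
    rw [Finset.prod_insert hi, Function.update_self, Finset.prod_congr rfl fun k hk => by
      rw [Function.update_of_ne (ne_of_mem_of_not_mem hk hi)]] at this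
    rwa [mul_left_comm, ← mul_assoc]

/-- Truncation makes the functions bounded; each is then divided by its supremum, and `h` by the
geometric mean `c` of the suprema. -/
theorem prekopaLeindler_real {κ : Type*} [Fintype κ] [Nonempty κ] :
    PrekopaLeindler (volume : Measure ℝ)
      (fun (x : κ → ℝ) z => Fintype.card κ * z = ∑ i, x i) := by
  intro f h hf hh H
  -- the case of bounded functions
  have key : ∀ g : κ → ℝ → ℝ≥0∞, (∀ i, Measurable (g i)) → (∀ i, ⨆ x, g i x ≠ ∞) →
      (∀ i x, g i x ≤ f i x) → ∏ i, ∫⁻ x, g i x ≤ (∫⁻ x, h x) ^ Fintype.card κ := by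
    intro g hg hfin hgf
    by_cases h0 : ∃ i, ⨆ x, g i x = 0
    · obtain ⟨i, hi⟩ := h0
      have : ∫⁻ x, g i x = 0 := by simp [fun x => ENNReal.iSup_eq_zero.1 hi x]
      rw [Finset.prod_eq_zero (Finset.mem_univ i) this]
      exact zero_le
    push Not at h0
    set m : κ → ℝ≥0∞ := fun i => ⨆ x, g i x
    have hN : (Fintype.card κ : ℝ) ≠ 0 := by simp
    set c : ℝ≥0∞ := (∏ i, m i) ^ ((Fintype.card κ : ℝ)⁻¹) with hc
    have hcN : c ^ Fintype.card κ = ∏ i, m i := by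
      rw [hc, ← ENNReal.rpow_natCast, ← ENNReal.rpow_mul, inv_mul_cancel₀ hN, ENNReal.rpow_one]
    have hP0 : ∏ i, m i ≠ 0 := Finset.prod_ne_zero_iff.2 fun i _ => h0 i
    have hPt : ∏ i, m i ≠ ∞ := ENNReal.prod_ne_top fun i _ => hfin i
    have hinv : (∏ i, m i)⁻¹ = ∏ i, (m i)⁻¹ :=
      ENNReal.prod_inv_distrib fun i _ j _ _ => Or.inl (h0 i)
    have h1 := prekopaLeindler_real_of_iSup_eq_one (f := fun i x => (m i)⁻¹ * g i x)
      (h := fun x => c⁻¹ * h x) (fun i => (hg i).const_mul _) (hh.const_mul _)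
      (fun i => by rw [← ENNReal.mul_iSup]; exact ENNReal.inv_mul_cancel (h0 i) (hfin i))
      (fun x z hz => by
        rw [Finset.prod_mul_distrib, mul_pow, ← ENNReal.inv_pow, hcN, hinv]
        gcongr
        exact (Finset.prod_le_prod' fun i _ => hgf i (x i)).trans (H x z hz))
    simp_rw [lintegral_const_mul _ (hg _), lintegral_const_mul _ hh] at h1
    rw [Finset.prod_mul_distrib, mul_pow, ← ENNReal.inv_pow, hcN, ← hinv] at h1
    exact (ENNReal.mul_le_mul_iff_right (ENNReal.inv_ne_zero.2 hPt) (ENNReal.inv_ne_top.2 hP0)).1 h1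
  have hmono : ∀ i, ∫⁻ x, f i x = ⨆ n : ℕ, ∫⁻ x, min (f i x) n := by
    intro i
    rw [← lintegral_iSup (fun n => (hf i).min measurable_const)
      fun n m hnm x => min_le_min le_rfl (by exact_mod_cast hnm)]
    refine lintegral_congr fun x => ?_
    rw [← inf_iSup_eq, ENNReal.iSup_natCast, inf_top_eq]
  simp only [hmono]
  rw [← mul_one (∏ i, _)]
  refine ENNReal.prod_iSup_mul_le _ _ _ _ fun m => ?_
  rw [mul_one]
  refine key _ (fun i => (hf i).min measurable_const) (fun i => ?_) fun i x => min_le_left _ _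
  exact ne_top_of_le_ne_top (ENNReal.natCast_ne_top (m i)) (iSup_le fun x => min_le_right _ _)

/-! ### Tensorisation and the multiplicative form -/

/-- Fubini: the inequality on `Y`, applied to fibres, is exactly the hypothesis on the fibre
integrals needed on `X`. -/
theorem PrekopaLeindler.prod {X Y : Type*} [MeasurableSpace X] [MeasurableSpace Y]
    {μ : Measure X} {ν : Measure Y} [SFinite ν] {κ : Type*} [Fintype κ]
    {M : (κ → X) → X → Prop} {M' : (κ → Y) → Y → Prop} (hM : PrekopaLeindler μ M)
    (hM' : PrekopaLeindler ν M') :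
    PrekopaLeindler (μ.prod ν)
      (fun x z => M (fun i => (x i).1) z.1 ∧ M' (fun i => (x i).2) z.2) := by
  intro f h hf hh H
  simp_rw [lintegral_prod _ (hf _).aemeasurable, lintegral_prod _ hh.aemeasurable]
  refine hM _ _ (fun i => (hf i).lintegral_prod_right') hh.lintegral_prod_right' fun x z hxz => ?_
  refine hM' _ _ (fun i => (hf i).comp measurable_prodMk_left) (hh.comp measurable_prodMk_left)
    fun y w hyw => H (fun i => (x i, y i)) (z, w) ⟨hxz, hyw⟩

theorem PrekopaLeindler.of_measurePreserving {X Y : Type*} [MeasurableSpace X]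
    [MeasurableSpace Y] {μ : Measure X} {ν : Measure Y} {κ : Type*} [Fintype κ]
    {M : (κ → X) → X → Prop} {M' : (κ → Y) → Y → Prop} (hM : PrekopaLeindler μ M)
    (e : X ≃ᵐ Y) (he : MeasurePreserving e μ ν)
    (hMM : ∀ x z, M x z → M' (fun i => e (x i)) (e z)) : PrekopaLeindler ν M' := by
  intro f h hf hh H
  simp only [← fun i => he.lintegral_comp (hf i), ← he.lintegral_comp hh]
  exact hM _ _ (fun i => (hf i).comp e.measurable) (hh.comp e.measurable)
    fun x z hxz => H _ _ (hMM x z hxz)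

theorem PrekopaLeindler.pi_fin {κ : Type*} [Fintype κ] {M : (κ → ℝ) → ℝ → Prop}
    (hM : PrekopaLeindler (volume : Measure ℝ) M) (n : ℕ) :
    PrekopaLeindler (volume : Measure (Fin n → ℝ)) (fun x z => ∀ l, M (fun i => x i l) (z l)) := by
  induction n with
  | zero =>
    intro f h hf hh H
    have hc := H (fun _ => default) default (fun l => l.elim0)
    have hv : (volume : Measure (Fin 0 → ℝ)) = Measure.dirac default :=
      Measure.pi_of_empty _ _
    simpa [hv, lintegral_dirac] using hc
  | succ n ih =>
    refine (hM.prod ih).of_measurePreserving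
      (MeasurableEquiv.piFinSuccAbove (fun _ : Fin (n + 1) => ℝ) 0).symm
      (volume_preserving_piFinSuccAbove (fun _ => ℝ) 0).symm fun x z hxz l => ?_
    refine Fin.cases ?_ (fun l => ?_) l
    · exact hxz.1
    · exact hxz.2 l

theorem PrekopaLeindler.pi {κ : Type*} [Fintype κ] {M : (κ → ℝ) → ℝ → Prop}
    (hM : PrekopaLeindler (volume : Measure ℝ) M) (ι : Type*) [Fintype ι] :
    PrekopaLeindler (volume : Measure (ι → ℝ)) (fun x z => ∀ l, M (fun i => x i l) (z l)) := by
  refine (hM.pi_fin (Fintype.card ι)).of_measurePreserving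
    (MeasurableEquiv.arrowCongr' (Fintype.equivFin ι).symm (MeasurableEquiv.refl ℝ))
    (volume_preserving_arrowCongr' _ _ (MeasurePreserving.id _)) fun x z hxz l => ?_
  exact hxz (Fintype.equivFin ι l)

theorem lintegral_eq_lintegral_exp {f : ℝ → ℝ≥0∞} (hf : Measurable f) :
    ∫⁻ x, f x = ∫⁻ t, ENNReal.ofReal (Real.exp t) * (f (Real.exp t) + f (-Real.exp t)) := by
  have hneg : ∫⁻ x in (Set.Ioi (0 : ℝ))ᶜ, f x = ∫⁻ x in Set.Ioi (0 : ℝ), f (-x) := by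
    rw [Set.compl_Ioi, setLIntegral_congr Iio_ae_eq_Iic.symm]
    have := (Measure.measurePreserving_neg (volume : Measure ℝ)).setLIntegral_comp_preimage
      (measurableSet_Iio (a := (0 : ℝ))) hf
    simpa using this.symm
  rw [← lintegral_add_compl f (measurableSet_Ioi (a := (0 : ℝ))), hneg,
    ← lintegral_add_left hf, ← Real.range_exp, ← Set.image_univ,
    lintegral_image_eq_lintegral_abs_deriv_mul MeasurableSet.univ
      (fun t _ => (Real.hasDerivAt_exp t).hasDerivWithinAt) Real.exp_injective.injOn,
    Measure.restrict_univ]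
  simp

/-- Substituting `x = ±exp t` turns geometric means into arithmetic ones, and the Jacobians match.
The relation ignores signs, so each `f i` may use its better sign and `h` its worse one; the factors
2 cancel. -/
theorem prekopaLeindler_real_mul {κ : Type*} [Fintype κ] [Nonempty κ] :
    PrekopaLeindler (volume : Measure ℝ)
      (fun (x : κ → ℝ) z => |z| ^ Fintype.card κ = ∏ i, |x i|) := by
  intro f h hf hh H
  simp_rw [lintegral_eq_lintegral_exp (hf _), lintegral_eq_lintegral_exp hh]
  refine prekopaLeindler_real _ _ (fun i => ?_) ?_ fun t u htu => ?_
  · have := hf i; fun_prop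
  · fun_prop
  have hN : Real.exp u ^ Fintype.card κ = ∏ i, Real.exp (t i) := by
    rw [← Real.exp_nat_mul, htu, Real.exp_sum]
  have hmax : ∀ i, ∃ y, |y| = Real.exp (t i) ∧
      f i (Real.exp (t i)) + f i (-Real.exp (t i)) ≤ 2 * f i y := by
    intro i
    rcases le_total (f i (Real.exp (t i))) (f i (-Real.exp (t i))) with hle | hle
    · exact ⟨-Real.exp (t i), by simp, by rw [two_mul]; gcongr⟩
    · exact ⟨Real.exp (t i), by simp, by rw [two_mul]; gcongr⟩
  have hmin : ∃ v, |v| = Real.exp u ∧ 2 * h v ≤ h (Real.exp u) + h (-Real.exp u) := by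
    rcases le_total (h (Real.exp u)) (h (-Real.exp u)) with hle | hle
    · exact ⟨Real.exp u, by simp, by rw [two_mul]; gcongr⟩
    · exact ⟨-Real.exp u, by simp, by rw [two_mul]; gcongr⟩
  choose y hy hfy using hmax
  obtain ⟨v, hv, hhv⟩ := hmin
  rw [Finset.prod_mul_distrib, mul_pow, ← ENNReal.ofReal_prod_of_nonneg fun i _ =>
    (Real.exp_pos _).le, ← hN, ENNReal.ofReal_pow (Real.exp_pos _).le]
  gcongr
  calc ∏ i, (f i (Real.exp (t i)) + f i (-Real.exp (t i))) ≤ ∏ i, (2 * f i (y i)) :=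
        Finset.prod_le_prod' fun i _ => hfy i
    _ = 2 ^ Fintype.card κ * ∏ i, f i (y i) := by
        rw [Finset.prod_mul_distrib, Finset.prod_const, Finset.card_univ]
    _ ≤ 2 ^ Fintype.card κ * h v ^ Fintype.card κ := by
        gcongr
        exact H y v (by simp only [hv, hy, hN])
    _ ≤ _ := by
        rw [← mul_pow]
        exact pow_le_pow_left' hhv _

theorem PrekopaLeindler.prod_measure_le {X κ : Type*} [MeasurableSpace X] [Fintype κ]
    [Nonempty κ] {μ : Measure X} {M : (κ → X) → X → Prop} (hM : PrekopaLeindler μ M)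
    {A : κ → Set X} {C : Set X} (hA : ∀ i, MeasurableSet (A i)) (hC : MeasurableSet C)
    (h : ∀ x z, (∀ i, x i ∈ A i) → M x z → z ∈ C) :
    ∏ i, μ (A i) ≤ μ C ^ Fintype.card κ := by
  classical
  have := hM (fun i => (A i).indicator 1) (C.indicator 1)
    (fun i => measurable_one.indicator (hA i)) (measurable_one.indicator hC) fun x z hxz => ?_
  · simpa only [lintegral_indicator_one (hA _), lintegral_indicator_one hC] using this
  by_cases hx : ∀ i, x i ∈ A i
  · simp [hx, h x z hx hxz]
  · push Not at hx
    obtain ⟨i, hi⟩ := hx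
    rw [Finset.prod_eq_zero (Finset.mem_univ i) (by simp [hi])]
    exact zero_le

/-! ### Maclaurin's inequality and the unconditional case -/

theorem prod_prod_powersetCard {α M : Type*} [Fintype α] [DecidableEq α] [CommMonoid M] (r : α → M)
    {j : ℕ} (hj : 1 ≤ j) :
    ∏ s ∈ Finset.powersetCard j Finset.univ, ∏ i ∈ s, r i =
      ∏ i, r i ^ (Fintype.card α - 1).choose (j - 1) := by
  rw [Finset.prod_comm' (t' := Finset.univ)
    (s' := fun i => {s ∈ Finset.powersetCard j Finset.univ | i ∈ s}) (by simp)]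
  refine Finset.prod_congr rfl fun i _ => ?_
  rw [Finset.prod_const]
  congr 1
  rw [← Finset.card_univ, ← Finset.card_erase_of_mem (Finset.mem_univ i),
    ← Finset.card_powersetCard]
  refine Finset.card_bij' (fun s _ => s.erase i) (fun s _ => insert i s) ?_ ?_ ?_ ?_
  · intro s hs
    simp only [Finset.mem_filter, Finset.mem_powersetCard] at hs ⊢
    exact ⟨Finset.erase_subset_erase _ (Finset.subset_univ _), by
      rw [Finset.card_erase_of_mem hs.2, hs.1.2]⟩
  · intro s hs
    simp only [Finset.mem_filter, Finset.mem_powersetCard] at hs ⊢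
    have hi : i ∉ s := fun h => by simpa using hs.1 h
    refine ⟨⟨Finset.subset_univ _, ?_⟩, Finset.mem_insert_self _ _⟩
    rw [Finset.card_insert_of_notMem hi, hs.2]; omega
  · intro s hs
    exact Finset.insert_erase (Finset.mem_filter.1 hs).2
  · intro s hs
    exact Finset.erase_insert fun h => by simpa using (Finset.mem_powersetCard.1 hs).1 h

/-- Maclaurin's inequality between the geometric mean and the elementary symmetric means. -/
theorem choose_mul_pow_le_elemSymm {k j : ℕ} (hj : 1 ≤ j) (hjk : j ≤ k) {r : Fin k → ℝ}
    (hr : ∀ i, 0 ≤ r i) {z : ℝ} (hz : 0 ≤ z) (hzr : z ^ k = ∏ i, r i) :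
    k.choose j * z ^ j ≤ elemSymm j r := by
  have hC : 0 < k.choose j := Nat.choose_pos hjk
  have hcard : (Finset.powersetCard j (Finset.univ : Finset (Fin k))).card = k.choose j := by
    simp
  have h := Real.prod_le_arith_mean_pow (Finset.powersetCard j (Finset.univ : Finset (Fin k)))
    (Finset.card_pos.1 (hcard ▸ hC)) (fun s => ∏ i ∈ s, r i)
    fun s _ => Finset.prod_nonneg fun i _ => hr i
  rw [prod_prod_powersetCard r hj, Finset.prod_pow, ← hzr, hcard, ← elemSymm_eq_sum,
    Fintype.card_fin, ← pow_mul] at h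
  -- This identity rewrites the product of all the monomials as `(z ^ j) ^ C(k,j)`, so the
  -- `C(k,j)`-th root can be taken.
  have hk : k * (k - 1).choose (j - 1) = j * k.choose j := by
    obtain ⟨j, rfl⟩ := Nat.exists_eq_add_of_le' hj
    obtain ⟨k, rfl⟩ := Nat.exists_eq_add_of_le' (hj.trans hjk)
    simpa [mul_comm] using Nat.add_one_mul_choose_eq k j
  rw [hk, pow_mul] at h
  have hs : 0 ≤ elemSymm j r := by
    rw [elemSymm_eq_sum]
    exact Finset.sum_nonneg fun s _ => Finset.prod_nonneg fun i _ => hr i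
  have := (pow_le_pow_iff_left₀ (by positivity) (by positivity) hC.ne').1 h
  rwa [le_div_iff₀' (by exact_mod_cast hC)] at this

/-- Changing the sign of the coordinates in `S`. -/
noncomputable def flipOn {ι : Type*} (S : Set ι) (x : ι → ℝ) : ι → ℝ :=
  open Classical in fun l => if l ∈ S then -x l else x l

/-- Only the negative coordinates are flipped, one at a time. -/
theorem abs_mem_of_flipOn_mem {ι : Type*} [Fintype ι] {A : Set (ι → ℝ)}
    (hA : ∀ l, ∀ x ∈ A, flipOn {l} x ∈ A) {x : ι → ℝ} (hx : x ∈ A) : (fun l => |x l|) ∈ A := by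
  classical
  have : ∀ T : Finset ι, (fun l => if l ∈ T then |x l| else x l) ∈ A := by
    intro T
    induction T using Finset.induction_on with
    | empty => simpa using hx
    | insert m T hm ih =>
      rcases le_total 0 (x m) with h0 | h0
      · convert ih using 2 with l
        rcases eq_or_ne l m with rfl | hl
        · simp [hm, abs_of_nonneg h0]
        · simp [hl]
      · convert hA m _ ih using 2 with l
        rcases eq_or_ne l m with rfl | hl
        · simp [flipOn, hm, abs_of_nonpos h0]
        · simp [flipOn, hl]
  simpa using this Finset.univ

/-- The set of `x` with `∑ |x l| ^ j ≤ 1`. -/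
def powBall (ι : Type*) [Fintype ι] (j : ℕ) : Set (ι → ℝ) := {x | ∑ l, |x l| ^ j ≤ 1}

theorem isClosed_powBall (ι : Type*) [Fintype ι] (j : ℕ) : IsClosed (powBall ι j) :=
  isClosed_le (by fun_prop) continuous_const

/-- The polarity condition for the elementary symmetric mean, for sets of functions. -/
def SymmPolar {k : ℕ} {ι : Type*} [Fintype ι] (j : ℕ) (A : Fin k → Set (ι → ℝ)) : Prop :=
  ∀ x : Fin k → ι → ℝ, (∀ i, x i ∈ A i) → ∑ l, elemSymm j (fun i => x i l) ≤ k.choose j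

theorem prod_volume_le_of_flipOn_mem {k j : ℕ} (hj : 1 ≤ j) (hjk : j ≤ k) {ι : Type*} [Fintype ι]
    {A : Fin k → Set (ι → ℝ)} (hm : ∀ i, MeasurableSet (A i)) (hA : SymmPolar j A)
    (hflip : ∀ i l, ∀ x ∈ A i, flipOn {l} x ∈ A i) :
    ∏ i, volume (A i) ≤ volume (powBall ι j) ^ k := by
  have : Nonempty (Fin k) := ⟨⟨0, by omega⟩⟩
  have h := (prekopaLeindler_real_mul (κ := Fin k)).pi ι |>.prod_measure_le hm
    (isClosed_powBall ι j).measurableSet ?_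
  · simpa using h
  intro x z hx hz
  have h1 := hA (fun i l => |x i l|) fun i => abs_mem_of_flipOn_mem (hflip i) (hx i)
  have h2 : ∀ l, k.choose j * |z l| ^ j ≤ elemSymm j (fun i => |x i l|) := fun l =>
    choose_mul_pow_le_elemSymm hj hjk (fun _ => abs_nonneg _) (abs_nonneg _) (by simpa using hz l)
  have h3 := (Finset.sum_le_sum fun l (_ : l ∈ Finset.univ) => h2 l).trans h1
  rw [← Finset.mul_sum] at h3
  have hC : (0 : ℝ) < k.choose j := by exact_mod_cast Nat.choose_pos hjk
  exact le_of_mul_le_mul_left (by simpa using h3) hC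

/-! ### Fibrewise symmetrization -/

/-- This is Brunn–Minkowski in product form for `A` and `-A`, which have equal volume. -/
theorem volume_le_of_half_sub_mem {σ : Type*} [Fintype σ] {A C : Set (σ → ℝ)}
    (hA : MeasurableSet A) (hC : MeasurableSet C)
    (h : ∀ a ∈ A, ∀ a' ∈ A, (fun l => (a l - a' l) / 2) ∈ C) : volume A ≤ volume C := by
  have h1 := ((prekopaLeindler_real (κ := Fin 2)).pi σ).prod_measure_le
    (A := ![A, -A]) (fun i => by fin_cases i; exacts [hA, hA.neg]) hC fun x z hx hz => by
      have hx0 : x 0 ∈ A := hx 0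
      have hx1 : -x 1 ∈ A := hx 1
      convert h _ hx0 _ hx1 using 2 with l
      have := hz l
      simp only [Fintype.card_fin, Fin.sum_univ_two] at this
      rw [eq_div_iff two_ne_zero, mul_comm]
      simpa using this
  simp only [Fin.prod_univ_two, Matrix.cons_val_zero, Matrix.cons_val_one, Measure.measure_neg,
    Fintype.card_fin, ← sq] at h1
  exact (ENNReal.pow_le_pow_left_iff two_ne_zero).1 h1

/-- The fibrewise difference body of `A` in the directions of the coordinates in `S`. -/
def symmetrize {ι : Type*} (S : Set ι) (A : Set (ι → ℝ)) : Set (ι → ℝ) :=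
  {z | ∃ u ∈ A, ∃ w ∈ A, (∀ l ∉ S, u l = z l ∧ w l = z l) ∧ ∀ l ∈ S, z l = (u l - w l) / 2}

section Symmetrize

variable {ι : Type*} {S : Set ι} {A : Set (ι → ℝ)}

theorem isCompact_symmetrize (hA : IsCompact A) : IsCompact (symmetrize S A) := by
  classical
  have hcl : IsClosed {p : (ι → ℝ) × (ι → ℝ) | ∀ l ∉ S, p.1 l = p.2 l} := by
    simp only [Set.ofPred_forall]
    exact isClosed_iInter fun l => isClosed_iInter fun _ => isClosed_eq (by fun_prop) (by fun_prop)
  have hcont : Continuous fun p : (ι → ℝ) × (ι → ℝ) =>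
      fun l => if l ∈ S then (p.1 l - p.2 l) / 2 else p.1 l := by
    refine continuous_pi fun l => ?_
    split_ifs <;> fun_prop
  convert ((hA.prod hA).inter_right hcl).image hcont using 1
  ext z
  constructor
  · rintro ⟨u, hu, w, hw, h1, h2⟩
    refine ⟨(u, w), ⟨⟨hu, hw⟩, fun l hl => (h1 l hl).1.trans (h1 l hl).2.symm⟩, ?_⟩
    ext l
    by_cases hl : l ∈ S
    · simp [hl, h2 l hl]
    · simp [hl, h1 l hl]
  · rintro ⟨⟨u, w⟩, ⟨⟨hu, hw⟩, h⟩, rfl⟩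
    refine ⟨u, hu, w, hw, fun l hl => ?_, fun l hl => by simp [hl]⟩
    have := h l hl
    simp_all

/-- With the coordinates outside `S` fixed, half-differences of points of a fibre `F` of `A` lie in
the new fibre; Fubini concludes. -/
theorem volume_le_volume_symmetrize [Fintype ι] (hA : IsCompact A) :
    volume A ≤ volume (symmetrize S A) := by
  classical
  let e := MeasurableEquiv.piEquivPiSubtypeProd (fun _ : ι => ℝ) (· ∈ S)
  have he : MeasurePreserving e.symm := (volume_preserving_piEquivPiSubtypeProd _ _).symm
  have hAm := hA.measurableSet
  have hSm := (isCompact_symmetrize (S := S) hA).measurableSet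
  rw [← he.measure_preimage hAm.nullMeasurableSet, ← he.measure_preimage hSm.nullMeasurableSet,
    Measure.volume_eq_prod, Measure.prod_apply_symm (e.symm.measurable hAm),
    Measure.prod_apply_symm (e.symm.measurable hSm)]
  refine lintegral_mono fun b => volume_le_of_half_sub_mem
    (measurable_prodMk_right (e.symm.measurable hAm))
    (measurable_prodMk_right (e.symm.measurable hSm)) fun a ha a' ha' => ?_
  refine ⟨_, ha, _, ha', fun l hl => ?_, fun l hl => ?_⟩
  · simp [e, MeasurableEquiv.piEquivPiSubtypeProd, Equiv.piEquivPiSubtypeProd, hl]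
  · simp [e, MeasurableEquiv.piEquivPiSubtypeProd, Equiv.piEquivPiSubtypeProd, hl]

theorem neg_mem_symmetrize (hA : ∀ x ∈ A, -x ∈ A) : ∀ z ∈ symmetrize S A, -z ∈ symmetrize S A := by
  rintro z ⟨u, hu, w, hw, h1, h2⟩
  refine ⟨-u, hA u hu, -w, hA w hw, fun l hl => ?_, fun l hl => ?_⟩
  · simp [h1 l hl]
  · simp only [Pi.neg_apply, h2 l hl]; ring

/-- Symmetries already gained survive, since both `u` and `w` can be flipped. -/
theorem flipOn_mem_symmetrize_of_flipOn_mem {T : Set ι} (hA : ∀ x ∈ A, flipOn T x ∈ A) :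
    ∀ z ∈ symmetrize S A, flipOn T z ∈ symmetrize S A := by
  rintro z ⟨u, hu, w, hw, h1, h2⟩
  refine ⟨_, hA u hu, _, hA w hw, fun l hl => ?_, fun l hl => ?_⟩
  · simp [flipOn, h1 l hl]
  · simp only [flipOn, h2 l hl]
    split_ifs <;> ring

/-- Exchanging `u` and `w` negates exactly the coordinates in `S`. -/
theorem flipOn_mem_symmetrize : ∀ z ∈ symmetrize S A, flipOn S z ∈ symmetrize S A := by
  rintro z ⟨u, hu, w, hw, h1, h2⟩
  refine ⟨w, hw, u, hu, fun l hl => ?_, fun l hl => ?_⟩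
  · simp [flipOn, hl, h1 l hl]
  · simp only [flipOn, hl, h2 l hl, if_true]; ring

end Symmetrize

/-! ### Symmetrization preserves polarity -/

theorem elemSymm_update_midpoint {k j : ℕ} (r : Fin k → ℝ) (i : Fin k) (s t : ℝ) :
    elemSymm j (Function.update r i ((s + t) / 2)) =
      (elemSymm j (Function.update r i s) + elemSymm j (Function.update r i t)) / 2 := by
  simp only [elemSymm_eq_sum]
  rw [← Finset.sum_add_distrib, Finset.sum_div]
  refine Finset.sum_congr rfl fun I _ => ?_
  by_cases hi : i ∈ I
  · simp only [Finset.prod_update_of_mem hi]; ring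
  · simp only [Finset.prod_update_of_notMem hi]; ring

theorem elemSymm_neg {k j : ℕ} (hj : Even j) (r : Fin k → ℝ) :
    elemSymm j (fun i => -r i) = elemSymm j r := by
  simp only [elemSymm_eq_sum]
  refine Finset.sum_congr rfl fun I hI => ?_
  rw [Finset.prod_neg, (Finset.mem_powersetCard.1 hI).2, hj.neg_one_pow, one_mul]

theorem elemSymm_self {k : ℕ} (r : Fin k → ℝ) : elemSymm k r = ∏ i, r i := by
  have h : Finset.powersetCard k (Finset.univ : Finset (Fin k)) = {Finset.univ} := by
    simpa using Finset.powersetCard_self (Finset.univ : Finset (Fin k))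
  rw [elemSymm_eq_sum, h, Finset.sum_singleton]

/-- The tuple obtained by symmetrizing `A a` in direction `l` and `A b` in all other directions. -/
def symmetrizePair {k : ℕ} {ι : Type*} (A : Fin k → Set (ι → ℝ)) (a b : Fin k) (l : ι) :
    Fin k → Set (ι → ℝ) :=
  Function.update (Function.update A a (symmetrize {l} (A a))) b (symmetrize {l}ᶜ (A b))

/-- Let `u, w` represent the new point in slot `a`, and `v, y` that in slot `b`. The sum at the new
points is the average of those at `(u, v)` and at `(w, -y)` with both `l`-th coordinates flipped. -/
theorem SymmPolar.symmetrizePair {k j : ℕ} {ι : Type*} [Fintype ι] {A : Fin k → Set (ι → ℝ)}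
    {a b : Fin k} {l : ι} (hA : SymmPolar j A) (hab : a ≠ b) (hneg : ∀ x ∈ A b, -x ∈ A b)
    (hflip : ∀ x : Fin k → ι → ℝ, (∀ i, x i ∈ A i) →
      ∑ m, elemSymm j (fun i => (if i = a ∨ i = b then flipOn {l} (x i) else x i) m) ≤
        k.choose j) : SymmPolar j (symmetrizePair A a b l) := by
  classical
  intro x hx
  have ha := hx a
  have hb := hx b
  simp only [_root_.symmetrizePair, Function.update_self, Function.update_of_ne hab] at ha hb
  obtain ⟨u, hu, w, hw, ha1, ha2⟩ := ha
  obtain ⟨v, hv, y, hy, hb1, hb2⟩ := hb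
  have hrest : ∀ i, i ≠ a → i ≠ b → x i ∈ A i := fun i hia hib => by
    simpa [_root_.symmetrizePair, hia, hib] using hx i
  have hmem : ∀ p ∈ A a, ∀ q ∈ A b, ∀ i,
      Function.update (Function.update x a p) b q i ∈ A i := by
    intro p hp q hq i
    rcases eq_or_ne i b with rfl | hib
    · simpa using hq
    rcases eq_or_ne i a with rfl | hia
    · simpa [hib] using hp
    simpa [hib, hia] using hrest i hia hib
  have h1 := hA _ (hmem u hu v hv)
  have h2 := hflip _ (hmem w hw (-y) (hneg y hy))
  suffices h : ∀ m, elemSymm j (fun i => x i m) =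
      (elemSymm j (fun i => Function.update (Function.update x a u) b v i m) +
        elemSymm j (fun i => (if i = a ∨ i = b then
          flipOn {l} (Function.update (Function.update x a w) b (-y) i)
          else Function.update (Function.update x a w) b (-y) i) m)) / 2 by
    rw [Finset.sum_congr rfl fun m _ => h m, ← Finset.sum_div, Finset.sum_add_distrib]
    linarith
  intro m
  -- At coordinate `l`, slot `a` is the midpoint of `u` and `-w` while slot `b` is constant; at
  -- other coordinates slot `b` is the midpoint of `v` and `-y` while slot `a` is constant.
  rcases eq_or_ne m l with rfl | hm
  · obtain ⟨hb1, hb1'⟩ := hb1 m (by simp)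
    have ha2 := ha2 m rfl
    have e0 : (fun i => x i m) = Function.update (fun i => x i m) a ((u m + -w m) / 2) := by
      rw [← sub_eq_add_neg, ← ha2, Function.update_eq_self]
    have e1 : (fun i => Function.update (Function.update x a u) b v i m) =
        Function.update (fun i => x i m) a (u m) := by
      ext i
      rcases eq_or_ne i b with rfl | hib
      · simp [hab.symm, hb1]
      · rcases eq_or_ne i a with rfl | hia
        · simp [hab]
        · simp [hia, hib]
    have e2 : (fun i => (if i = a ∨ i = b then
        flipOn {m} (Function.update (Function.update x a w) b (-y) i)
        else Function.update (Function.update x a w) b (-y) i) m) =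
        Function.update (fun i => x i m) a (-w m) := by
      ext i
      rcases eq_or_ne i b with rfl | hib
      · simp [hab.symm, hb1', flipOn]
      · rcases eq_or_ne i a with rfl | hia
        · simp [hab, flipOn]
        · simp [hia, hib]
    rw [e1, e2]
    conv_lhs => rw [e0]
    exact elemSymm_update_midpoint _ _ _ _
  · have hb2 := hb2 m hm
    obtain ⟨ha1, ha1'⟩ := ha1 m hm
    have e0 : (fun i => x i m) = Function.update (fun i => x i m) b ((v m + -y m) / 2) := by
      rw [← sub_eq_add_neg, ← hb2, Function.update_eq_self]
    have e1 : (fun i => Function.update (Function.update x a u) b v i m) =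
        Function.update (fun i => x i m) b (v m) := by
      ext i
      rcases eq_or_ne i b with rfl | hib
      · simp
      · rcases eq_or_ne i a with rfl | hia
        · simp [hab, ha1]
        · simp [hia, hib]
    have e2 : (fun i => (if i = a ∨ i = b then
        flipOn {l} (Function.update (Function.update x a w) b (-y) i)
        else Function.update (Function.update x a w) b (-y) i) m) =
        Function.update (fun i => x i m) b (-y m) := by
      ext i
      rcases eq_or_ne i b with rfl | hib
      · simp [flipOn, hm]
      · rcases eq_or_ne i a with rfl | hia
        · simp [hab, flipOn, hm, ha1']
        · simp [hia, hib]
    rw [e1, e2]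
    conv_lhs => rw [e0]
    exact elemSymm_update_midpoint _ _ _ _

/-- The hypotheses of the volume inequality that are preserved under symmetrization. -/
structure IsSymmetrizable {k : ℕ} {ι : Type*} [Fintype ι] (j : ℕ) (A : Fin k → Set (ι → ℝ)) :
    Prop where
  isCompact : ∀ i, IsCompact (A i)
  neg_mem : ∀ i, ∀ x ∈ A i, -x ∈ A i
  polar : SymmPolar j A
  cases : j = k ∨ Even j ∧ ∀ i : Fin k, 2 ≤ (i : ℕ) → ∀ l, ∀ x ∈ A i, flipOn {l} x ∈ A i

namespace IsSymmetrizable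

variable {k j : ℕ} {ι : Type*} [Fintype ι] {A : Fin k → Set (ι → ℝ)} {a b : Fin k} {l : ι}

/-- For `j = k` the product at coordinate `l` acquires two signs, which cancel. -/
theorem sum_elemSymm_flip_le_of_eq (hA : SymmPolar k A) (hab : a ≠ b)
    (x : Fin k → ι → ℝ) (hx : ∀ i, x i ∈ A i) :
    ∑ m, elemSymm k (fun i => (if i = a ∨ i = b then flipOn {l} (x i) else x i) m) ≤
      k.choose k := by
  classical
  refine (Finset.sum_congr rfl fun m _ => ?_).trans_le (hA x hx)
  rw [elemSymm_self, elemSymm_self]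
  have hsign : ∀ i, (if i = a ∨ i = b then flipOn {l} (x i) else x i) m =
      (if i = a then (if m = l then -1 else 1) else 1) *
        ((if i = b then (if m = l then -1 else 1) else 1) * x i m) := by
    intro i
    rcases eq_or_ne i a with rfl | hia
    · by_cases hm : m = l <;> simp [hab, flipOn, hm]
    · rcases eq_or_ne i b with rfl | hib
      · by_cases hm : m = l <;> simp [hia, flipOn, hm]
      · simp [hia, hib]
  simp only [hsign, Finset.prod_mul_distrib, Finset.prod_ite_eq', Finset.mem_univ, if_true]
  split_ifs <;> ring

/-- At coordinate `l`, flipping slots `a` and `b` is flipping all other slots and then negating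
everything; an even `s_j` ignores the latter. -/
theorem sum_elemSymm_flip_le_of_even (hj : Even j) (hA : SymmPolar j A)
    (hflip : ∀ i, i ≠ a → i ≠ b → ∀ x ∈ A i, flipOn {l} x ∈ A i)
    (x : Fin k → ι → ℝ) (hx : ∀ i, x i ∈ A i) :
    ∑ m, elemSymm j (fun i => (if i = a ∨ i = b then flipOn {l} (x i) else x i) m) ≤
      k.choose j := by
  have h := hA (fun i => if i = a ∨ i = b then x i else flipOn {l} (x i)) fun i => by
    by_cases hi : i = a ∨ i = b
    · simpa [hi] using hx i
    · simp only [if_neg hi]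
      push Not at hi
      exact hflip i hi.1 hi.2 _ (hx i)
  refine (Finset.sum_congr rfl fun m _ => ?_).trans_le h
  rcases eq_or_ne m l with rfl | hm
  · rw [← elemSymm_neg hj]
    congr 1
    ext i
    split_ifs <;> simp [flipOn]
  · congr 1
    ext i
    split_ifs <;> simp [flipOn, hm]

theorem symmetrizePair (hA : IsSymmetrizable j A) (hab : a ≠ b)
    (h : j = k ∨ ∀ i : Fin k, i ≠ a → i ≠ b → 2 ≤ (i : ℕ)) :
    IsSymmetrizable j (symmetrizePair A a b l) ∧
      (∀ i, volume (A i) ≤ volume (_root_.symmetrizePair A a b l i)) ∧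
      (∀ i m, (∀ x ∈ A i, flipOn {m} x ∈ A i) →
        ∀ x ∈ _root_.symmetrizePair A a b l i, flipOn {m} x ∈ _root_.symmetrizePair A a b l i) ∧
      ∀ x ∈ _root_.symmetrizePair A a b l a, flipOn {l} x ∈ _root_.symmetrizePair A a b l a := by
  have hval : ∀ i, _root_.symmetrizePair A a b l i = A i ∨
      ∃ S, _root_.symmetrizePair A a b l i = symmetrize S (A i) := by
    intro i
    unfold _root_.symmetrizePair
    rcases eq_or_ne i b with rfl | hib
    · exact Or.inr ⟨_, Function.update_self _ _ _⟩
    · rcases eq_or_ne i a with rfl | hia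
      · exact Or.inr ⟨{l}, by simp [hib]⟩
      · exact Or.inl (by simp [hib, hia])
  have hpres : ∀ i m, (∀ x ∈ A i, flipOn {m} x ∈ A i) →
      ∀ x ∈ _root_.symmetrizePair A a b l i, flipOn {m} x ∈ _root_.symmetrizePair A a b l i := by
    intro i m him
    rcases hval i with hi | ⟨S, hi⟩ <;> rw [hi]
    · exact him
    · exact flipOn_mem_symmetrize_of_flipOn_mem him
  refine ⟨⟨fun i => ?_, fun i => ?_, ?_, ?_⟩, fun i => ?_, hpres, ?_⟩
  · rcases hval i with hi | ⟨S, hi⟩ <;> rw [hi]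
    exacts [hA.isCompact i, isCompact_symmetrize (hA.isCompact i)]
  · rcases hval i with hi | ⟨S, hi⟩ <;> rw [hi]
    exacts [hA.neg_mem i, neg_mem_symmetrize (hA.neg_mem i)]
  · refine hA.polar.symmetrizePair hab (hA.neg_mem b) ?_
    by_cases hjk : j = k
    · subst hjk
      exact sum_elemSymm_flip_le_of_eq hA.polar hab
    · obtain ⟨hj, hi⟩ := hA.cases.resolve_left hjk
      exact sum_elemSymm_flip_le_of_even hj hA.polar fun i hia hib =>
        hi i (h.resolve_left hjk i hia hib) l
  · exact hA.cases.imp_right fun hc => ⟨hc.1, fun i hi m => hpres i m (hc.2 i hi m)⟩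
  · rcases hval i with hi | ⟨S, hi⟩ <;> rw [hi]
    exact volume_le_volume_symmetrize (hA.isCompact i)
  · simp only [_root_.symmetrizePair, Function.update_of_ne hab, Function.update_self]
    exact flipOn_mem_symmetrize

theorem exists_flipOn_mem (hk : 2 ≤ k) (hA : IsSymmetrizable j A) (a : Fin k) (l : ι) :
    ∃ B : Fin k → Set (ι → ℝ), IsSymmetrizable j B ∧ (∀ i, volume (A i) ≤ volume (B i)) ∧
      (∀ i m, (∀ x ∈ A i, flipOn {m} x ∈ A i) → ∀ x ∈ B i, flipOn {m} x ∈ B i) ∧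
      ∀ x ∈ B a, flipOn {l} x ∈ B a := by
  by_cases ha : j ≠ k ∧ 2 ≤ (a : ℕ)
  · exact ⟨A, hA, fun _ => le_rfl, fun _ _ => id, (hA.cases.resolve_left ha.1).2 a ha.2 l⟩
  -- The partner of slot 0 is slot 1, and of any other slot is slot 0. Slots count from 0, so when
  -- `j ≠ k` the pair is exactly the two slots not assumed unconditional.
  obtain ⟨b, hab, hb⟩ : ∃ b : Fin k, a ≠ b ∧
      (j = k ∨ ∀ i : Fin k, i ≠ a → i ≠ b → 2 ≤ (i : ℕ)) := by
    by_cases ha0 : (a : ℕ) = 0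
    · refine ⟨⟨1, by omega⟩, fun h => by simp [h] at ha0, Or.inr fun i hia hib => ?_⟩
      simp only [ne_eq, Fin.ext_iff] at hia hib
      omega
    · refine ⟨⟨0, by omega⟩, fun h => by simp [h] at ha0, ?_⟩
      by_cases hjk : j = k
      · exact Or.inl hjk
      refine Or.inr fun i hia hib => ?_
      simp only [ne_eq, Fin.ext_iff] at hia hib
      omega
  exact ⟨_, hA.symmetrizePair hab hb⟩

/-- One symmetrization per pair (slot, coordinate) suffices, because none destroys an earlier
symmetry. -/
theorem prod_volume_le (hj : 2 ≤ j) (hjk : j ≤ k) (hA : IsSymmetrizable j A) :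
    ∏ i, volume (A i) ≤ volume (powBall ι j) ^ k := by
  classical
  have key : ∀ T : Finset (Fin k × ι), ∃ B : Fin k → Set (ι → ℝ), IsSymmetrizable j B ∧
      (∀ i, volume (A i) ≤ volume (B i)) ∧ ∀ p ∈ T, ∀ x ∈ B p.1, flipOn {p.2} x ∈ B p.1 := by
    intro T
    induction T using Finset.induction_on with
    | empty => exact ⟨A, hA, fun _ => le_rfl, by simp⟩
    | insert p T hp ih =>
      obtain ⟨B, hB, hvol, hflip⟩ := ih
      obtain ⟨C, hC, hvol', hpres, hCp⟩ := hB.exists_flipOn_mem (hj.trans hjk) p.1 p.2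
      refine ⟨C, hC, fun i => (hvol i).trans (hvol' i), fun q hq => ?_⟩
      rcases Finset.mem_insert.1 hq with rfl | hq
      · exact hCp
      · exact hpres _ _ (hflip q hq)
  obtain ⟨B, hB, hvol, hflip⟩ := key Finset.univ
  exact (Finset.prod_le_prod' fun i _ => hvol i).trans
    (prod_volume_le_of_flipOn_mem (by omega) hjk (fun i => (hB.isCompact i).measurableSet)
      hB.polar fun i l => hflip (i, l) (Finset.mem_univ _))

end IsSymmetrizable

/-! ### The extremal ball -/

theorem isCompact_powBall (ι : Type*) [Fintype ι] {j : ℕ} (hj : j ≠ 0) :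
    IsCompact (powBall ι j) := by
  refine (isCompact_Icc (a := (-1 : ι → ℝ)) (b := 1)).of_isClosed_subset
    (isClosed_powBall ι j) fun x hx => ?_
  have h : ∀ l, |x l| ≤ 1 := fun l => by
    have h1 : |x l| ^ j ≤ 1 := (Finset.single_le_sum (f := fun l => |x l| ^ j)
      (fun _ _ => by positivity) (Finset.mem_univ l)).trans hx
    exact (pow_le_one_iff_of_nonneg (abs_nonneg _) hj).1 h1
  exact ⟨fun l => (abs_le.1 (h l)).1, fun l => (abs_le.1 (h l)).2⟩

theorem convex_powBall (ι : Type*) [Fintype ι] (j : ℕ) : Convex ℝ (powBall ι j) := by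
  intro x hx y hy a b ha hb hab
  have h : ∀ l, |(a • x + b • y) l| ^ j ≤ a * |x l| ^ j + b * |y l| ^ j := by
    intro l
    have h1 : |a * x l + b * y l| ≤ a * |x l| + b * |y l| := by
      simpa [abs_mul, abs_of_nonneg ha, abs_of_nonneg hb] using abs_add_le (a * x l) (b * y l)
    exact (pow_le_pow_left₀ (abs_nonneg _) h1 j).trans
      ((convexOn_pow j).2 (abs_nonneg (x l)) (abs_nonneg (y l)) ha hb hab)
  refine (Finset.sum_le_sum fun l _ => h l).trans ?_
  rw [Finset.sum_add_distrib, ← Finset.mul_sum, ← Finset.mul_sum]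
  calc _ ≤ a * 1 + b * 1 := by gcongr <;> assumption
    _ = 1 := by rw [mul_one, mul_one, hab]

theorem Real.prod_le_sum_pow_div {κ : Type*} {s : Finset κ} (hs : s.Nonempty) {r : κ → ℝ}
    (hr : ∀ i, 0 ≤ r i) : ∏ i ∈ s, r i ≤ (∑ i ∈ s, r i ^ s.card) / s.card := by
  have h := Real.prod_le_arith_mean_pow s hs (fun i => r i ^ s.card)
    fun i _ => pow_nonneg (hr i) _
  rw [Finset.prod_pow] at h
  exact (pow_le_pow_iff_left₀ (Finset.prod_nonneg fun i _ => hr i)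
    (div_nonneg (Finset.sum_nonneg fun i _ => pow_nonneg (hr i) _) (Nat.cast_nonneg _))
    (Finset.card_pos.2 hs).ne').1 h

/-- AM–GM bounds each monomial by the mean of the `|x i l| ^ j` over its `j` factors; summing over
`l` first makes each subset contribute at most 1. -/
theorem symmPolar_powBall {k j : ℕ} (hj : 1 ≤ j) (ι : Type*) [Fintype ι] :
    SymmPolar j (fun _ : Fin k => powBall ι j) := by
  intro x hx
  have hj0 : (0 : ℝ) < j := by exact_mod_cast hj
  calc ∑ l, elemSymm j (fun i => x i l)
      ≤ ∑ l, ∑ s ∈ Finset.powersetCard j Finset.univ, (∑ i ∈ s, |x i l| ^ j) / j := by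
        refine Finset.sum_le_sum fun l _ => ?_
        rw [elemSymm_eq_sum]
        refine Finset.sum_le_sum fun s hs => ?_
        have hc := (Finset.mem_powersetCard.1 hs).2
        refine (le_abs_self _).trans ?_
        rw [Finset.abs_prod]
        have := Real.prod_le_sum_pow_div (s := s) (Finset.card_pos.1 (by omega))
          (r := fun i => |x i l|) fun i => abs_nonneg _
        rwa [hc] at this
    _ = ∑ s ∈ Finset.powersetCard j (Finset.univ : Finset (Fin k)),
          (∑ i ∈ s, ∑ l, |x i l| ^ j) / j := by
        rw [Finset.sum_comm]
        refine Finset.sum_congr rfl fun s _ => ?_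
        rw [← Finset.sum_div, Finset.sum_comm]
    _ ≤ ∑ s ∈ Finset.powersetCard j (Finset.univ : Finset (Fin k)), 1 := by
        refine Finset.sum_le_sum fun s hs => ?_
        rw [div_le_one hj0]
        refine (Finset.sum_le_sum fun i _ => hx i).trans ?_
        simp [(Finset.mem_powersetCard.1 hs).2]
    _ = k.choose j := by simp

/-! ### Transfer to Euclidean space and conclusion -/

theorem mem_lpBall_iff {n j : ℕ} (hj : j ≠ 0) (x : EuclideanSpace ℝ (Fin n)) :
    x ∈ lpBall n (j : ℝ) ↔ WithLp.ofLp x ∈ powBall (Fin n) j := by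
  have h0 : 0 ≤ ∑ m, |x m| ^ j := Finset.sum_nonneg fun m _ => by positivity
  simp only [lpBall, lpFunctional, powBall, Real.rpow_natCast, Set.mem_ofPred_eq]
  constructor
  · intro h
    by_contra! hlt
    exact not_lt.2 h (Real.one_lt_rpow hlt (by positivity))
  · exact fun h => Real.rpow_le_one h0 h (by positivity)

theorem toLp_preimage_eq_image_ofLp {n : ℕ} (K : Set (EuclideanSpace ℝ (Fin n))) :
    WithLp.toLp 2 ⁻¹' K = WithLp.ofLp '' K := by
  ext x
  exact ⟨fun h => ⟨_, h, rfl⟩, fun ⟨y, hy, h⟩ => h ▸ hy⟩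

theorem volume_preimage_toLp {n : ℕ} {K : Set (EuclideanSpace ℝ (Fin n))} (hK : MeasurableSet K) :
    volume (WithLp.toLp 2 ⁻¹' K : Set (Fin n → ℝ)) = volume K :=
  (PiLp.volume_preserving_toLp (Fin n)).measure_preimage hK.nullMeasurableSet

theorem toLp_preimage_lpBall {n j : ℕ} (hj : j ≠ 0) :
    WithLp.toLp 2 ⁻¹' lpBall n (j : ℝ) = powBall (Fin n) j := by
  ext x
  exact mem_lpBall_iff hj _

theorem polarityCondition_iff_symmPolar {n k j : ℕ} (hjk : j ≤ k)
    (K : Fin k → Set (EuclideanSpace ℝ (Fin n))) :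
    PolarityCondition (coordSymmMean j) K ↔ SymmPolar j fun i => WithLp.toLp 2 ⁻¹' K i := by
  have hC : (0 : ℝ) < k.choose j := by exact_mod_cast Nat.choose_pos hjk
  simp only [PolarityCondition, coordSymmMean, coordSymm, div_le_one hC]
  exact ⟨fun h x hx => h (fun i => WithLp.toLp 2 (x i)) hx,
    fun h x hx => h (fun i => WithLp.ofLp (x i)) hx⟩

theorem IsUnconditional.flipOn_mem {n : ℕ} {K : Set (EuclideanSpace ℝ (Fin n))}
    (hK : IsUnconditional K) (l : Fin n) :
    ∀ x ∈ (WithLp.toLp 2 ⁻¹' K : Set (Fin n → ℝ)),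
      flipOn {l} x ∈ (WithLp.toLp 2 ⁻¹' K : Set (Fin n → ℝ)) := by
  intro x hx
  have h := (hK (fun m => if m = l then -1 else 1) (fun m => by split_ifs <;> simp)
    (WithLp.toLp 2 x)).2 hx
  have heq : flipOn {l} x = fun m => (if m = l then -1 else 1) * x m := by
    ext m
    by_cases hm : m = l <;> simp [flipOn, hm]
  rw [heq]
  exact h

theorem isSymmConvexBody_lpBall (n : ℕ) {j : ℕ} (hj : j ≠ 0) :
    IsSymmConvexBody (lpBall n (j : ℝ)) := by
  have himage : lpBall n (j : ℝ) = WithLp.toLp 2 '' powBall (Fin n) j := by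
    ext x
    rw [mem_lpBall_iff hj]
    exact ⟨fun h => ⟨_, h, rfl⟩, fun ⟨y, hy, h⟩ => h ▸ hy⟩
  refine ⟨fun x hx y hy a b ha hb hab => ?_, ?_, ⟨0, ?_⟩, fun x hx => ?_⟩
  · rw [mem_lpBall_iff hj] at *
    exact convex_powBall _ _ hx hy ha hb hab
  · rw [himage]
    exact (isCompact_powBall _ hj).image (PiLp.continuous_toLp 2 _)
  -- The strict sublevel set is an open neighbourhood of 0, as `0 ^ j = 0` for `j ≠ 0`.
  · refine mem_interior.2 ⟨{x | ∑ m, |x m| ^ j < 1}, fun x hx => ?_,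
      isOpen_lt (by fun_prop) continuous_const, by simp [hj]⟩
    exact (mem_lpBall_iff hj x).2 (le_of_lt (Set.mem_ofPred_eq ▸ hx))
  · rw [mem_lpBall_iff hj] at *
    simpa [powBall] using hx

theorem isUnconditional_lpBall (n : ℕ) {j : ℕ} (hj : j ≠ 0) :
    IsUnconditional (lpBall n (j : ℝ)) := by
  intro δ hδ x
  have habs : ∀ l, |δ l| = 1 := fun l => by rcases hδ l with h | h <;> simp [h]
  simp [mem_lpBall_iff hj, powBall, abs_mul, habs]

theorem mainTheorem1 (n j k : ℕ) (hj : 2 ≤ j) (hjk : j ≤ k) :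
    (∀ K : Fin k → Set (EuclideanSpace ℝ (Fin n)),
      (∀ i, IsSymmConvexBody (K i)) →
      PolarityCondition (coordSymmMean j) K →
      ((∀ i, IsUnconditional (K i)) ∨
        j = k ∨
        (Even j ∧ ∀ i : Fin k, 2 ≤ (i : ℕ) → IsUnconditional (K i))) →
      ∏ i, volume (K i) ≤ volume (lpBall n (j : ℝ)) ^ k) ∧
    (IsSymmConvexBody (lpBall n (j : ℝ)) ∧
      IsUnconditional (lpBall n (j : ℝ)) ∧
      PolarityCondition (coordSymmMean j) (fun _ : Fin k => lpBall n (j : ℝ)) ∧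
      ∏ _i : Fin k, volume (lpBall n (j : ℝ)) = volume (lpBall n (j : ℝ)) ^ k) := by
  have hj0 : j ≠ 0 := by omega
  refine ⟨fun K hK hpol hcase => ?_, isSymmConvexBody_lpBall n hj0, isUnconditional_lpBall n hj0,
    ?_, by simp⟩
  · rw [polarityCondition_iff_symmPolar hjk] at hpol
    have hcomp : ∀ i, IsCompact (WithLp.toLp 2 ⁻¹' K i : Set (Fin n → ℝ)) := fun i => by
      rw [toLp_preimage_eq_image_ofLp]
      exact (hK i).isCompact.image (PiLp.continuous_ofLp 2 _)
    rw [← volume_preimage_toLp (isSymmConvexBody_lpBall n hj0).isCompact.measurableSet,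
      toLp_preimage_lpBall hj0, ← Finset.prod_congr rfl fun i _ =>
        volume_preimage_toLp (hK i).isCompact.measurableSet]
    rcases hcase with hunc | hcase
    · exact prod_volume_le_of_flipOn_mem (by omega) hjk (fun i => (hcomp i).measurableSet) hpol
        fun i l => (hunc i).flipOn_mem l
    · have hA : IsSymmetrizable j fun i => (WithLp.toLp 2 ⁻¹' K i : Set (Fin n → ℝ)) :=
        ⟨hcomp, fun i x hx => (hK i).symm _ hx, hpol, hcase.imp_right fun h =>
          ⟨h.1, fun i hi l => (h.2 i hi).flipOn_mem l⟩⟩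
      exact hA.prod_volume_le hj hjk
  · rw [polarityCondition_iff_symmPolar hjk]
    simp only [toLp_preimage_lpBall hj0]
    exact symmPolar_powBall (by omega) _
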